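/- Setting. Let $d,n\ge 0$ and $L\ge1$ be integers, and let $u_\theta(x)=W_L\,\sigma(W_{L-1}\,\sigma(\cdots\sigma(W_1x)\cdots))$, $x\in\mathbb R^d$, be a fully connected network with weight matrices $W_l\in\mathbb R^{m_l\times m_{l-1}}$, $m_0=d$, $m_L=1$, where $\sigma:\mathbb R\to\mathbb R$ acts entrywise and $\theta$ is the vector of all entries of $W_1,\dots,W_L$. Let $\Omega\subset\mathbb R^d$, $x_1,\dots,x_{N_r}\in\Omega$ (residual points), $R:\mathbb R^d\to\mathbb R$, and let $\mathcal L=\sum_{i=1}^{N_{\mathcal L}}\mathcal L_i$ be a differential operator of order at most $n$: $\mathcal L_iu(x)=\mathcal L_i\big(x,u(x),\partial_xu(x),\dots,\partial_x^nu(x)\big)$ for a function $\mathcal L_i:\mathbb R^{d+1+d+\cdots+d^n}\to\mathbb R$. The loss is $$\ell(\theta)=\frac1{2N_rN_{\mathcal L}^2}\sum_{r=1}^{N_r}\big(\mathcal Lu_\theta(x_r)-R(x_r)\big)^2 .$$ Stochastic gradients. Let the batch sizes $|B|,|I|,|J|\ge1$ be fixed. The batch $B$ of indices in $\{1,\dots,N_r\}$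 and the batches $I,J$ of indices in $\{1,\dots,N_{\mathcal L}\}$ are independent of each other, and each is drawn uniformly, either with or without replacement. Algorithms 1 and 2 use, respectively, $$g_{B,I}(\theta)=\frac1{|B||I|N_{\mathcal L}}\sum_{r\in B}\big(\mathcal Lu_\theta(x_r)-R(x_r)\big)\sum_{i\in I}\partial_\theta\mathcal L_iu_\theta(x_r),$$ $$g_{B,I,J}(\theta)=\frac1{|B||I|N_{\mathcal L}}\sum_{r\in B}\Big(\frac{N_{\mathcal L}}{|J|}\sum_{j\in J}\mathcal L_ju_\theta(x_r)-R(x_r)\Big)\sum_{i\in I}\partial_\theta\mathcal L_iu_\theta(x_r).$$ The iterates are $\theta^{k+1}=\theta^k-\gamma_k\,g^{(k)}(\theta^k)$, $k\ge1$, where $g^{(k)}$ is the stochastic gradient of the chosen algorithm with fresh batches, independent over $k$ and independent of the (possibly random) initial value $\theta^1$. Assumptions. (a) $\sigma$ is $C^\infty$, and $|\sigma^{(k)}|\le1$ and $\sigma^{(k)}$ is $1$-Lipschitz for $0\le k\le n$; $R$ is bounded on $\Omega$. (b) Each $\mathcal L_i$ is bounded on compact sets; for every $x\in\Omega$ it is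 differentiable in its arguments $(u,\partial_xu,\dots,\partial_x^nu)$, with a derivative that is bounded on compact sets. (c) $\theta^*$ is a regular minimizer: a local minimizer of $\ell$ at which the Hessian exists and is positive definite. (d) $\gamma_k=\gamma/(k+m)^p$ with $p\in(1/2,1]$. Theorem. Assume (a)-(d) and let $\delta>0$. If $\gamma$ is large enough, and $m>0$ is large enough (depending on $\gamma$), then there are open neighborhoods $\mathcal U,\mathcal U_1$ of $\theta^*$ and a constant $C$ such that the following holds for all iterates $(\theta^k)$ of Algorithm 1 or of Algorithm 2 that almost surely satisfy $\|W_l^k\|\le M(l)<\infty$ for all $k$ and $l$ (where $W_l^k$ are the weight matrices of $\theta^k$ and $\|\cdot\|$ is the matrix $2$-norm), with $\mathbb P(\theta^1\in\mathcal U_1)>0$: 1. The event $E_\infty=\{\theta^k\in\mathcal U\text{ for all }k\ge1\}$ satisfies $\mathbb P(E_\infty\mid\theta^1\in\mathcal U_1)\ge1-\delta$. 2. Conditioned on $E_\infty$ and on the start $\theta^1\in\mathcal U_1$, the variable $\|\theta^k-\theta^*\|^2$ is integrable and $$\mathbb E\big[\|\theta^k-\theta^*\|^2\,\big|\,\theta^1\in\mathcal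 U_1,\,E_\infty\big]\le\frac{C}{k^p}\qquad\text{for all }k\ge1 .$$ -/

import Mathlib

open MeasureTheory ProbabilityTheory

noncomputable section

namespace SDGD

/-! ### The neural network -/

/-- The shape of a fully connected network with `hidden` hidden layers, i.e. of depth
`L = hidden + 1`, and with layer widths `width 0 = d, width 1, …, width L = 1`.
(The values `width l` with `l > L` play no role.) -/
structure Architecture where
  hidden : ℕ
  width : ℕ → ℕ
  width_output : width (hidden + 1) = 1

namespace Architecture

/-- The depth `L`. -/
abbrev depth (A : Architecture) : ℕ := A.hidden + 1

/-- The input space `ℝ^d`, where `d` is the width of layer `0`. -/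
abbrev Input (A : Architecture) : Type := EuclideanSpace ℝ (Fin (A.width 0))

/-- The entries of all weight matrices: the layer `l`, the row and the column. -/
abbrev ParamIndex (A : Architecture) : Type :=
  Σ l : Fin A.depth, Fin (A.width (l.val + 1)) × Fin (A.width l.val)

/-- The space of parameter vectors `θ`: the vectorization of all the weight matrices,
with the Euclidean norm. -/
abbrev Param (A : Architecture) : Type := EuclideanSpace ℝ A.ParamIndex

variable {A : Architecture}

/-- The weight matrix with index `l`. With layers numbered from `1`, this is `W_{l+1}`,
a matrix with `width (l+1)` rows and `width l` columns. -/
def weight (θ : A.Param) (l : Fin A.depth) :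
    Matrix (Fin (A.width (l.val + 1))) (Fin (A.width l.val)) ℝ :=
  Matrix.of fun i j => θ ⟨l, (i, j)⟩

open scoped Matrix.Norms.L2Operator in
/-- The matrix `2`-norm (spectral norm) of a weight matrix. -/
def weightNorm (θ : A.Param) (l : Fin A.depth) : ℝ := ‖weight θ l‖

/-- The output of the first `l ≤ L - 1` layers, activation included:
`σ (W_l σ (⋯ σ (W_1 x)))`, and `x` itself for `l = 0`. -/
def activation (σ : ℝ → ℝ) (θ : A.Param) (x : A.Input) :
    (l : ℕ) → l ≤ A.hidden → Fin (A.width l) → ℝ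
  | 0, _ => fun i => x i
  | l + 1, h => fun i =>
      σ ((weight θ ⟨l, by unfold depth; omega⟩).mulVec
        (activation σ θ x l (Nat.le_of_succ_le h)) i)

/-- The network `u_θ(x) = W_L σ (W_{L-1} σ (⋯ σ (W_1 x)))`. The last layer has width one,
and there is no activation after it. -/
def network (σ : ℝ → ℝ) (θ : A.Param) (x : A.Input) : ℝ :=
  (weight θ ⟨A.hidden, Nat.lt_succ_self _⟩).mulVec (activation σ θ x A.hidden le_rfl)
    ⟨0, by simp [A.width_output]⟩

end Architecture

/-! ### Differential operators and the loss -/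

/-- The space `ℝ^{1 + d + ⋯ + d^n}` of the values of the derivatives of orders `0, …, n` of a
function on `ℝ^d`. -/
abbrev Jet (d n : ℕ) : Type := (k : Fin (n + 1)) → (Fin k.val → Fin d) → ℝ

/-- `(u(x), ∂u/∂x (x), …, ∂ⁿu/∂xⁿ (x))`, where the tensor of order `k` has the entries
`∂ᵏu / ∂x_{i_1} ⋯ ∂x_{i_k}`. -/
def jet {d : ℕ} (n : ℕ) (u : EuclideanSpace ℝ (Fin d) → ℝ) (x : EuclideanSpace ℝ (Fin d)) :
    Jet d n :=
  fun k i => iteratedFDeriv ℝ k.val u x fun a => EuclideanSpace.single (i a) (1 : ℝ)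

/-- The data of a physics-informed network problem: the activation `σ`, the domain, the residual
points in it, the order `n` of the equation, the right-hand side `R`, and the terms `𝓛_i` of the
operator `𝓛 = ∑ i, 𝓛_i`, each a function of `x` and of the derivatives of order at most `n`. -/
structure Problem (A : Architecture) where
  σ : ℝ → ℝ
  domain : Set A.Input
  numPoints : ℕ
  point : Fin numPoints → A.Input
  point_mem : ∀ r, point r ∈ domain
  order : ℕ
  rhs : A.Input → ℝ
  numTerms : ℕ
  op : Fin numTerms → A.Input → Jet (A.width 0) order → ℝ

namespace Problem

open Architecture

variable {A : Architecture} (pb : Problem A)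

/-- `𝓛_i u_θ (x)`. -/
def term (i : Fin pb.numTerms) (θ : A.Param) (x : A.Input) : ℝ :=
  pb.op i x (jet pb.order (network pb.σ θ) x)

/-- `∂/∂θ 𝓛_i u_θ (x)`. -/
def termGrad (i : Fin pb.numTerms) (θ : A.Param) (x : A.Input) : A.Param :=
  gradient (fun η => pb.term i η x) θ

/-- `𝓛 u_θ (x) - R(x)`. -/
def residual (θ : A.Param) (x : A.Input) : ℝ := (∑ i, pb.term i θ x) - pb.rhs x

/-- The loss `1 / (2 N_r N_𝓛²) ∑_r (𝓛 u_θ (x_r) - R(x_r))²`. -/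
def loss (θ : A.Param) : ℝ :=
  1 / (2 * (pb.numPoints : ℝ) * (pb.numTerms : ℝ) ^ 2) *
    ∑ r, (pb.residual θ (pb.point r)) ^ 2

/-- The activation is smooth, its derivatives of orders `0, …, n` are bounded by `1` and
`1`-Lipschitz, and `R` is bounded on the domain. -/
structure ActivationAssumption : Prop where
  smooth : ContDiff ℝ ((⊤ : ℕ∞) : WithTop ℕ∞) pb.σ
  bounded : ∀ k ≤ pb.order, ∀ t, |iteratedDeriv k pb.σ t| ≤ 1
  lipschitz : ∀ k ≤ pb.order, LipschitzWith 1 (iteratedDeriv k pb.σ)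
  rhs_bounded : ∃ K : ℝ, ∀ x ∈ pb.domain, |pb.rhs x| ≤ K

/-- Every `𝓛_i` is bounded on compact sets. So that `∂/∂θ 𝓛_i u_θ` makes sense and is bounded as
well while `θ` is, `𝓛_i` is differentiable in `(u, ∂u, …, ∂ⁿu)` at the points of the domain, with a
derivative that is bounded on compact sets. -/
structure OperatorAssumption : Prop where
  bounded : ∀ i, ∀ K : Set (A.Input × Jet (A.width 0) pb.order), IsCompact K →
    Bornology.IsBounded ((fun q => pb.op i q.1 q.2) '' K)
  differentiable : ∀ i, ∀ x ∈ pb.domain, Differentiable ℝ (pb.op i x)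
  deriv_bounded : ∀ i, ∀ x ∈ pb.domain, ∀ K : Set (Jet (A.width 0) pb.order), IsCompact K →
    Bornology.IsBounded (fderiv ℝ (pb.op i x) '' K)

/-- A regular minimizer: a local minimizer of the loss at which the Hessian, i.e. the derivative
of the gradient, exists and is positive definite. -/
structure IsRegularMinimizer (θs : A.Param) : Prop where
  isLocalMin : IsLocalMin pb.loss θs
  differentiableAt_gradient : DifferentiableAt ℝ (gradient pb.loss) θs
  hessian_pos : ∀ v : A.Param, v ≠ 0 → 0 < inner ℝ (fderiv ℝ (gradient pb.loss) θs v) v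

end Problem

/-! ### Stochastic gradients -/

/-- How the indices of a batch are drawn. -/
inductive Sampling
  | withReplacement
  | withoutReplacement

/-- The possible batches of `b` indices out of `N`, listed in the order of drawing. -/
def Sampling.batches (s : Sampling) (b N : ℕ) : Set (Fin b → Fin N) :=
  match s with
  | .withReplacement => Set.univ
  | .withoutReplacement => {f | Function.Injective f}

/-- The law of a batch: uniform on the possible batches. With replacement, these are `b`
independent uniform indices; without replacement, the set of drawn indices is a uniform
`b`-element subset. -/
def Sampling.law (s : Sampling) (b N : ℕ) : Measure (Fin b → Fin N) :=
  uniformOn (s.batches b N)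

namespace Problem

variable {A : Architecture} (pb : Problem A)

/-- `g_{B,I}(θ) = 1 / (|B| |I| N_𝓛) ∑_{r ∈ B} (𝓛 u_θ (x_r) - R(x_r)) ∑_{i ∈ I} ∂/∂θ 𝓛_i u_θ (x_r)`:
sampling in the backward pass. -/
def sdgdGrad1 {b k : ℕ} (θ : A.Param)
    (ξ : (Fin b → Fin pb.numPoints) × (Fin k → Fin pb.numTerms)) : A.Param :=
  (1 / ((b : ℝ) * k * pb.numTerms)) •
    ∑ a, pb.residual θ (pb.point (ξ.1 a)) • ∑ c, pb.termGrad (ξ.2 c) θ (pb.point (ξ.1 a))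

/-- `g_{B,I,J}(θ) = 1 / (|B| |I| N_𝓛) ∑_{r ∈ B} ((N_𝓛 / |J|) ∑_{j ∈ J} 𝓛_j u_θ (x_r) - R(x_r))
∑_{i ∈ I} ∂/∂θ 𝓛_i u_θ (x_r)`: sampling in the backward and in the forward pass. -/
def sdgdGrad2 {b k j : ℕ} (θ : A.Param)
    (ξ : (Fin b → Fin pb.numPoints) × (Fin k → Fin pb.numTerms) × (Fin j → Fin pb.numTerms)) :
    A.Param :=
  (1 / ((b : ℝ) * k * pb.numTerms)) •
    ∑ a, ((pb.numTerms : ℝ) / j * (∑ e, pb.term (ξ.2.2 e) θ (pb.point (ξ.1 a)))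
        - pb.rhs (pb.point (ξ.1 a))) •
      ∑ c, pb.termGrad (ξ.2.1 c) θ (pb.point (ξ.1 a))

end Problem

/-! ### Trajectories -/

/-- `θ` is a trajectory of stochastic gradient descent with the stochastic gradient `g`, whose
samples `ξ n` are independent with law `ν` and independent of the initial value, which may be
random. `θ n` and `γ n` are the iterate and the step size number `n + 1`. -/
structure IsSGD {Ω S Θ : Type*} [MeasurableSpace Ω] [MeasurableSpace S] [MeasurableSpace Θ]
    [AddCommGroup Θ] [Module ℝ Θ] (P : Measure Ω) (ν : Measure S) (g : Θ → S → Θ) (γ : ℕ → ℝ)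
    (ξ : ℕ → Ω → S) (θ : ℕ → Ω → Θ) : Prop where
  measurable_sample : ∀ n, Measurable (ξ n)
  measurable_init : Measurable (θ 0)
  law_sample : ∀ n, P.map (ξ n) = ν
  indep_samples : iIndepFun ξ P
  indep_init : IndepFun (θ 0) (fun ω n => ξ n ω) P
  step : ∀ n ω, θ (n + 1) ω = θ n ω - γ n • g (θ n ω) (ξ n ω)

namespace Problem

variable {A : Architecture} (pb : Problem A)

/-- A trajectory of the algorithm that samples `b` residual points and `k` terms of the operator
in the backward pass, independently of each other. -/
def IsTrajectory1 {Ω : Type*} [MeasurableSpace Ω] (P : Measure Ω) (sp st : Sampling) (b k : ℕ)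
    (γ : ℕ → ℝ) (θ : ℕ → Ω → A.Param) : Prop :=
  ∃ ξ : ℕ → Ω → (Fin b → Fin pb.numPoints) × (Fin k → Fin pb.numTerms),
    IsSGD P ((sp.law b pb.numPoints).prod (st.law k pb.numTerms)) pb.sdgdGrad1 γ ξ θ

/-- A trajectory of the algorithm that samples `b` residual points, `k` terms of the operator in
the backward pass and `j` terms in the forward pass, independently of each other. -/
def IsTrajectory2 {Ω : Type*} [MeasurableSpace Ω] (P : Measure Ω) (sp st : Sampling) (b k j : ℕ)
    (γ : ℕ → ℝ) (θ : ℕ → Ω → A.Param) : Prop :=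
  ∃ ξ : ℕ → Ω → (Fin b → Fin pb.numPoints) × (Fin k → Fin pb.numTerms) × (Fin j → Fin pb.numTerms),
    IsSGD P ((sp.law b pb.numPoints).prod
      ((st.law k pb.numTerms).prod (st.law j pb.numTerms))) pb.sdgdGrad2 γ ξ θ

end Problem

/-- Almost surely, the norms of the weight matrices of every layer are bounded along the
trajectory. -/
def IsBoundedTrajectory {A : Architecture} {Ω : Type*} [MeasurableSpace Ω] (P : Measure Ω)
    (θ : ℕ → Ω → A.Param) : Prop :=
  ∀ᵐ ω ∂P, ∃ M : Fin A.depth → ℝ, ∀ n l, Architecture.weightNorm (θ n ω) l ≤ M l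

end SDGD

end

/-! Near a regular minimizer, stochastic gradient descent is a noisy contraction. The gradient of
the loss vanishes at `θs` and its derivative there is positive definite, so on a ball of some radius
r one has ⟨∇ℓ(θ), θ - θs⟩ ≥ c ‖θ - θs‖² (`exists_ball_mul_sq_le_inner`). The stochastic gradients
are unbiased (`integral_inner_sdgdGrad1`, `integral_inner_sdgdGrad2`) and bounded by a constant G on
the ball. Expanding the square of one step, the mean squared distance is multiplied by 1 - 2cγ_k and
increased by at most G²γ_k².

This holds only while the iterates stay in the ball, and conditioning on staying forever would
destroy unbiasedness, since that event depends on future samples. The integrals are therefore taken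
over the event A_n that the start is in the smaller ball and the iterates up to n are in the larger
one; it is determined by the past and independent of the sample n (`IsSGD.setIntegral_confined`).
The mass lost between A_n and A_{n+1} carries squared distance at least r², so it is paid for by the
initial distance and by G² ∑ γ_k². Both are small for a small starting ball and large m, because 2p
> 1.

The same recursion, with cγ ≥ 1, decays like k^{-p} (`le_div_rpow_of_recursion`). The event of
staying forever lies in every A_n and has at least half the mass of the starting event, so
conditioning on it costs a factor 2 (`IsSGD.local_convergence`). -/

namespace SDGD

open scoped ContDiff
open Architecture

/-! ### Smooth dependence of the network and its jet on the parameters. -/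

/-- The iterated derivatives of a smooth family of functions depend smoothly on the parameter and
the point. -/
theorem contDiff_iteratedFDeriv_family {E F G : Type*} [NormedAddCommGroup E] [NormedSpace ℝ E]
    [NormedAddCommGroup F] [NormedSpace ℝ F] [NormedAddCommGroup G] [NormedSpace ℝ G]
    {f : E → F → G} (hf : ContDiff ℝ ∞ fun q : E × F => f q.1 q.2) (k : ℕ) :
    ContDiff ℝ ∞ fun q : E × F => iteratedFDeriv ℝ k (f q.1) q.2 := by
  induction k with
  | zero =>
    simp only [iteratedFDeriv_zero_eq_comp, Function.comp_apply]
    exact (continuousMultilinearCurryFin0 ℝ F G).symm.contDiff.comp hf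
  | succ k ih =>
    simp only [iteratedFDeriv_succ_eq_comp_left, Function.comp_apply]
    -- Only the derivative in the space variable is wanted, so the point of differentiation y is
    -- decoupled from the base point `q.2`. Smoothness of order ∞ survives the loss of one
    -- derivative per step.
    have h : ContDiff ℝ ∞ (Function.uncurry fun (q : E × F) (y : F) =>
        iteratedFDeriv ℝ k (f q.1) y) :=
      ih.comp ((contDiff_fst.comp contDiff_fst).prodMk contDiff_snd)
    have h' : ContDiff ℝ ∞ fun q : E × F => fderiv ℝ (iteratedFDeriv ℝ k (f q.1)) q.2 :=
      h.fderiv contDiff_snd (by simp)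
    exact h'.continuousLinearMap_comp
      ((continuousMultilinearCurryLeftEquiv ℝ (fun _ : Fin (k + 1) => F) G).symm :
        _ →L[ℝ] F [×(k + 1)]→L[ℝ] G)

namespace Architecture

variable {A : Architecture}

theorem contDiff_mulVec_weight {X : Type*} [NormedAddCommGroup X] [NormedSpace ℝ X]
    {θ : X → A.Param} (hθ : ContDiff ℝ ∞ θ) (l : Fin A.depth) {v : X → Fin (A.width l.val) → ℝ}
    (hv : ContDiff ℝ ∞ v) (i : Fin (A.width (l.val + 1))) :
    ContDiff ℝ ∞ fun q => (weight (θ q) l).mulVec (v q) i := by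
  simp only [Matrix.mulVec, dotProduct, weight, Matrix.of_apply]
  refine ContDiff.sum fun j _ => ContDiff.mul ?_ ((contDiff_pi.1 hv) j)
  exact (EuclideanSpace.proj (𝕜 := ℝ) (⟨l, (i, j)⟩ : A.ParamIndex)).contDiff.comp hθ

theorem contDiff_activation {σ : ℝ → ℝ} (hσ : ContDiff ℝ ∞ σ) :
    ∀ (l : ℕ) (h : l ≤ A.hidden),
      ContDiff ℝ ∞ fun q : A.Param × A.Input => activation σ q.1 q.2 l h
  | 0, _ => contDiff_pi.2 fun i =>
      (EuclideanSpace.proj (𝕜 := ℝ) i).contDiff.comp contDiff_snd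
  | l + 1, h => contDiff_pi.2 fun i => hσ.comp
      (contDiff_mulVec_weight contDiff_fst ⟨l, Nat.lt_succ_of_le (Nat.le_of_succ_le h)⟩
        (contDiff_activation hσ l (Nat.le_of_succ_le h)) i)

theorem contDiff_network {σ : ℝ → ℝ} (hσ : ContDiff ℝ ∞ σ) :
    ContDiff ℝ ∞ fun q : A.Param × A.Input => network σ q.1 q.2 :=
  contDiff_mulVec_weight contDiff_fst _ (contDiff_activation hσ _ le_rfl) _

theorem contDiff_jet_network {σ : ℝ → ℝ} (hσ : ContDiff ℝ ∞ σ) (n : ℕ) (x : A.Input) :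
    ContDiff ℝ ∞ fun θ : A.Param => jet n (network σ θ) x := by
  refine contDiff_pi.2 fun k => contDiff_pi.2 fun i => ?_
  have h := (contDiff_iteratedFDeriv_family (contDiff_network (A := A) hσ) k.val).comp
    (contDiff_id.prodMk (contDiff_const (c := x)))
  exact (ContinuousMultilinearMap.apply ℝ (fun _ : Fin k.val => A.Input) ℝ
    fun a => EuclideanSpace.single (i a) (1 : ℝ)).contDiff.comp h

end Architecture

/-! ### Regularity of the terms of the operator and the gradient of the loss. -/

namespace Problem

variable {A : Architecture} {pb : Problem A}

theorem differentiable_term (hσ : pb.ActivationAssumption) (hop : pb.OperatorAssumption)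
    (i : Fin pb.numTerms) {x : A.Input} (hx : x ∈ pb.domain) :
    Differentiable ℝ fun θ => pb.term i θ x :=
  (hop.differentiable i x hx).comp
    ((contDiff_jet_network hσ.smooth pb.order x).differentiable (by simp))

/-- The derivative of `pb.op i x` need not be continuous, so compactness alone gives no bound. The
chain rule splits off the derivative of the jet, which is continuous; the other factor is bounded on
the compact set of jets by `deriv_bounded`. -/
theorem exists_norm_termGrad_le (hσ : pb.ActivationAssumption) (hop : pb.OperatorAssumption)
    (i : Fin pb.numTerms) {x : A.Input} (hx : x ∈ pb.domain) {K : Set A.Param}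
    (hK : IsCompact K) : ∃ M : ℝ, ∀ θ ∈ K, ‖pb.termGrad i θ x‖ ≤ M := by
  have hjet := contDiff_jet_network (A := A) hσ.smooth pb.order x
  have hdiff := hjet.differentiable (by simp)
  obtain ⟨M₁, hM₁⟩ := (hop.deriv_bounded i x hx _
    (hK.image hjet.continuous)).exists_norm_le
  obtain ⟨M₂, hM₂⟩ := (hK.image (hjet.continuous_fderiv (by simp))).isBounded.exists_norm_le
  refine ⟨M₁ * M₂, fun θ hθ => ?_⟩
  have h₁ := hM₁ _ (Set.mem_image_of_mem _ (Set.mem_image_of_mem _ hθ))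
  have h₂ := hM₂ _ (Set.mem_image_of_mem _ hθ)
  have : fderiv ℝ (fun η => pb.term i η x) θ =
      (fderiv ℝ (pb.op i x) (jet pb.order (network pb.σ θ) x)).comp
        (fderiv ℝ (fun η : A.Param => jet pb.order (network pb.σ η) x) θ) :=
    fderiv_comp θ (hop.differentiable i x hx _) (hdiff θ)
  rw [termGrad, gradient, LinearIsometryEquiv.norm_map, this]
  exact (ContinuousLinearMap.opNorm_comp_le _ _).trans
    (mul_le_mul h₁ h₂ (norm_nonneg _) ((norm_nonneg _).trans h₁))

theorem exists_abs_term_le (hσ : pb.ActivationAssumption) (hop : pb.OperatorAssumption)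
    (i : Fin pb.numTerms) {x : A.Input} (hx : x ∈ pb.domain) {K : Set A.Param}
    (hK : IsCompact K) : ∃ M : ℝ, ∀ θ ∈ K, |pb.term i θ x| ≤ M := by
  obtain ⟨M, hM⟩ := (hK.image
    (differentiable_term hσ hop i hx).continuous).isBounded.exists_norm_le
  exact ⟨M, fun θ hθ => hM _ (Set.mem_image_of_mem _ hθ)⟩

/-- The derivative of an arbitrary function is Borel measurable, so continuity of the gradient is
not needed. -/
theorem measurable_termGrad (i : Fin pb.numTerms) (x : A.Input) :
    Measurable fun θ => pb.termGrad i θ x :=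
  (InnerProductSpace.toDual ℝ A.Param).symm.continuous.measurable.comp (measurable_fderiv ℝ _)

theorem measurable_term (hσ : pb.ActivationAssumption) (hop : pb.OperatorAssumption)
    (i : Fin pb.numTerms) {x : A.Input} (hx : x ∈ pb.domain) :
    Measurable fun θ => pb.term i θ x :=
  (differentiable_term hσ hop i hx).continuous.measurable

/-- The derivative of the loss. -/
theorem inner_gradient_loss (hσ : pb.ActivationAssumption) (hop : pb.OperatorAssumption)
    (θ v : A.Param) :
    inner ℝ (gradient pb.loss θ) v =
      1 / ((pb.numPoints : ℝ) * (pb.numTerms : ℝ) ^ 2) * ∑ r, pb.residual θ (pb.point r) *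
        ∑ i, inner ℝ (pb.termGrad i θ (pb.point r)) v := by
  have ht (i r) := (differentiable_term hσ hop i (pb.point_mem r) θ).hasFDerivAt
  have hres (r) : HasFDerivAt (fun η => pb.residual η (pb.point r)) _ θ :=
    (HasFDerivAt.fun_sum fun i _ => ht i r).sub_const (pb.rhs (pb.point r))
  have hl : HasFDerivAt pb.loss _ θ :=
    (HasFDerivAt.fun_sum fun r _ => (hres r).pow 2).const_mul
      (1 / (2 * (pb.numPoints : ℝ) * (pb.numTerms : ℝ) ^ 2))
  rw [inner_gradient_left, hl.fderiv]
  simp only [termGrad, inner_gradient_left, _root_.smul_apply,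
    _root_.sum_apply, smul_eq_mul, Finset.mul_sum]
  refine Finset.sum_congr rfl fun r _ => Finset.sum_congr rfl fun i _ => ?_
  simp only [one_div, mul_inv]
  ring

end Problem

end SDGD

namespace SDGD

/-! ### Uniform marginals of the batches. -/

namespace Sampling

theorem batches_comp_equiv (s : Sampling) {b N : ℕ} (e : Equiv.Perm (Fin N)) (f : Fin b → Fin N) :
    e ∘ f ∈ s.batches b N ↔ f ∈ s.batches b N := by
  cases s
  · simp [batches]
  · exact e.injective.of_comp_iff f

/-- Relabelling the indices permutes the admissible batches. This symmetry is all that is needed of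
the law, and it treats both ways of sampling at once. -/
theorem law_real_singleton_comp_equiv (s : Sampling) {b N : ℕ} (e : Equiv.Perm (Fin N))
    (f : Fin b → Fin N) : (s.law b N).real {e ∘ f} = (s.law b N).real {f} := by
  classical
  have h (f : Fin b → Fin N) : Measure.count (s.batches b N ∩ {f}) =
      if f ∈ s.batches b N then 1 else 0 := by
    split_ifs with hf
    · rw [Set.inter_eq_right.2 (Set.singleton_subset_iff.2 hf), Measure.count_singleton]
    · rw [Set.inter_singleton_eq_empty.2 hf, measure_empty]
  simp only [Measure.real, law, uniformOn, cond_apply (Set.toFinite _).measurableSet, h,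
    batches_comp_equiv]

theorem integral_law_comp_equiv (s : Sampling) {b N : ℕ} (e : Equiv.Perm (Fin N))
    (f : (Fin b → Fin N) → ℝ) : ∫ ω, f (e ∘ ω) ∂s.law b N = ∫ ω, f ω ∂s.law b N := by
  have : IsFiniteMeasure (s.law b N) := by unfold law; infer_instance
  rw [integral_fintype .of_finite, integral_fintype .of_finite]
  refine .trans ?_ ((Equiv.arrowCongr (Equiv.refl (Fin b)) e).sum_comp _)
  refine Finset.sum_congr rfl fun ω _ => ?_
  change _ = (s.law b N).real {e ∘ ω} • f (e ∘ ω)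
  rw [law_real_singleton_comp_equiv]

/-- Every index of a batch is uniformly distributed. -/
theorem integral_law_apply (s : Sampling) {b N : ℕ} [IsProbabilityMeasure (s.law b N)]
    (f : Fin N → ℝ) (a : Fin b) : ∫ ω, f (ω a) ∂s.law b N = 1 / (N : ℝ) * ∑ r, f r := by
  obtain ⟨ω₀⟩ : Nonempty (Fin b → Fin N) := (s.law b N).nonempty_of_neZero
  have : NeZero N := ⟨fun h => by subst h; exact (ω₀ a).elim0⟩
  have hN : (N : ℝ) ≠ 0 := Nat.cast_ne_zero.2 (NeZero.ne N)
  -- Average over all cyclic shifts: each shift c preserves the law, while for a fixed batch c + ω a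
  -- runs through all indices.
  have h : (N : ℝ) * ∫ ω, f (ω a) ∂s.law b N = ∑ r, f r := by
    calc (N : ℝ) * ∫ ω, f (ω a) ∂s.law b N
        = ∑ c : Fin N, ∫ ω, f (c + ω a) ∂s.law b N := by
          have (c : Fin N) : ∫ ω, f (c + ω a) ∂s.law b N = ∫ ω, f (ω a) ∂s.law b N :=
            integral_law_comp_equiv s (Equiv.addLeft c) fun ω => f (ω a)
          simp [this]
      _ = ∫ ω, ∑ c : Fin N, f (c + ω a) ∂s.law b N :=
          (integral_finsetSum _ fun _ _ => .of_finite).symm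
      _ = ∑ r, f r := by
          have (ω : Fin b → Fin N) : ∑ c : Fin N, f (c + ω a) = ∑ r, f r :=
            Equiv.sum_comp (Equiv.addRight (ω a)) f
          simp [this]
  rw [← h]
  field_simp

theorem integral_law_sum (s : Sampling) {b N : ℕ} [IsProbabilityMeasure (s.law b N)]
    (f : Fin N → ℝ) : ∫ ω, ∑ a, f (ω a) ∂s.law b N = b / (N : ℝ) * ∑ r, f r := by
  rw [integral_finsetSum _ fun _ _ => .of_finite]
  simp only [integral_law_apply, Finset.sum_const, Finset.card_univ, Fintype.card_fin,
    nsmul_eq_mul]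
  ring

/-- The law is zero exactly when there is no admissible batch, for instance when more indices are
drawn without replacement than exist. -/
theorem isProbabilityMeasure_law_of_ne_zero (s : Sampling) {b N : ℕ} (h : s.law b N ≠ 0) :
    IsProbabilityMeasure (s.law b N) := by
  have : IsZeroOrProbabilityMeasure (s.law b N) := by unfold law; infer_instance
  exact (eq_zero_or_isProbabilityMeasure (s.law b N)).resolve_left h

end Sampling

/-! ### The stochastic gradients: unbiased, measurable, locally bounded. -/

namespace Problem

open Architecture

variable {A : Architecture} {pb : Problem A}

/-- `B` and `I` are independent, so the mean is an iterated integral. Each is a mean of a sum over a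
batch, for which the marginals suffice; this gives the factors k / N_𝓛 and b / N_r. -/
theorem integral_inner_sdgdGrad1 (hσ : pb.ActivationAssumption) (hop : pb.OperatorAssumption)
    (sp st : Sampling) {b k : ℕ} (hb : 0 < b) (hk : 0 < k)
    [IsProbabilityMeasure (sp.law b pb.numPoints)] [IsProbabilityMeasure (st.law k pb.numTerms)]
    (θ v : A.Param) :
    ∫ ξ, inner ℝ (pb.sdgdGrad1 θ ξ) v ∂((sp.law b pb.numPoints).prod (st.law k pb.numTerms)) =
      inner ℝ (gradient pb.loss θ) v := by
  rw [inner_gradient_loss hσ hop, integral_prod _ .of_finite]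
  simp only [sdgdGrad1, real_inner_smul_left, sum_inner, integral_const_mul]
  have (B : Fin b → Fin pb.numPoints) :
      ∫ I, ∑ a, pb.residual θ (pb.point (B a)) *
        ∑ c, inner ℝ (pb.termGrad (I c) θ (pb.point (B a))) v ∂(st.law k pb.numTerms) =
      ∑ a, pb.residual θ (pb.point (B a)) *
        (k / pb.numTerms * ∑ i, inner ℝ (pb.termGrad i θ (pb.point (B a))) v) := by
    rw [integral_finsetSum _ fun _ _ => .of_finite]
    refine Finset.sum_congr rfl fun a _ => ?_
    rw [integral_const_mul, Sampling.integral_law_sum st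
      fun i => inner ℝ (pb.termGrad i θ (pb.point (B a))) v]
  simp only [this]
  rw [Sampling.integral_law_sum sp fun r => pb.residual θ (pb.point r) *
    (k / pb.numTerms * ∑ i, inner ℝ (pb.termGrad i θ (pb.point r)) v)]
  simp only [Finset.mul_sum]
  refine Finset.sum_congr rfl fun r _ => Finset.sum_congr rfl fun i _ => ?_
  have hb' : (b : ℝ) ≠ 0 := by positivity
  have hk' : (k : ℝ) ≠ 0 := by positivity
  field_simp

/-- For fixed `B` and `I`, averaging over the independent batch `J` turns the sampled forward pass
into the full residual, which leaves the gradient of the first algorithm. -/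
theorem integral_inner_sdgdGrad2 (hσ : pb.ActivationAssumption) (hop : pb.OperatorAssumption)
    (sp st : Sampling) {b k j : ℕ} (hb : 0 < b) (hk : 0 < k) (hj : 0 < j)
    [IsProbabilityMeasure (sp.law b pb.numPoints)] [IsProbabilityMeasure (st.law k pb.numTerms)]
    [IsProbabilityMeasure (st.law j pb.numTerms)] (θ v : A.Param) :
    ∫ ξ, inner ℝ (pb.sdgdGrad2 θ ξ) v ∂((sp.law b pb.numPoints).prod
      ((st.law k pb.numTerms).prod (st.law j pb.numTerms))) =
      inner ℝ (gradient pb.loss θ) v := by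
  rw [← integral_inner_sdgdGrad1 hσ hop sp st hb hk, integral_prod _ .of_finite,
    integral_prod _ .of_finite]
  refine integral_congr_ae (.of_forall fun B => ?_)
  change ∫ q, _ ∂_ = ∫ I, _ ∂_
  rw [integral_prod _ .of_finite]
  refine integral_congr_ae (.of_forall fun I => ?_)
  obtain ⟨J₀⟩ : Nonempty (Fin j → Fin pb.numTerms) := (st.law j pb.numTerms).nonempty_of_neZero
  have hN : (pb.numTerms : ℝ) ≠ 0 := by
    have := (J₀ ⟨0, hj⟩).pos
    positivity
  have hj' : (j : ℝ) ≠ 0 := by positivity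
  simp only [sdgdGrad1, sdgdGrad2, real_inner_smul_left, sum_inner, integral_const_mul]
  rw [integral_finsetSum _ fun _ _ => .of_finite]
  congr 1
  refine Finset.sum_congr rfl fun a _ => ?_
  rw [integral_mul_const, integral_sub .of_finite .of_finite, integral_const_mul,
    Sampling.integral_law_sum st fun i => pb.term i θ (pb.point (B a))]
  simp only [integral_const, probReal_univ, one_smul, residual]
  congr 2
  field_simp

theorem measurable_sdgdGrad1 (hσ : pb.ActivationAssumption) (hop : pb.OperatorAssumption)
    {b k : ℕ} : Measurable (Function.uncurry (pb.sdgdGrad1 (b := b) (k := k))) := by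
  -- The samples form a finite set, so it suffices to fix one.
  refine measurable_from_prod_countable_left fun ξ => ?_
  have hr (r : Fin pb.numPoints) : Measurable fun θ => pb.residual θ (pb.point r) :=
    (Finset.measurable_fun_sum _ fun i _ =>
      measurable_term hσ hop i (pb.point_mem r)).sub_const _
  have hc (r : Fin pb.numPoints) : Measurable fun θ => ∑ c, pb.termGrad (ξ.2 c) θ (pb.point r) :=
    Finset.measurable_fun_sum _ fun c _ => measurable_termGrad _ _
  have h : Measurable fun θ => ∑ a, pb.residual θ (pb.point (ξ.1 a)) •
      ∑ c, pb.termGrad (ξ.2 c) θ (pb.point (ξ.1 a)) :=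
    Finset.measurable_fun_sum _ fun a _ => (hr (ξ.1 a)).smul (hc (ξ.1 a))
  exact h.const_smul (1 / ((b : ℝ) * k * pb.numTerms))

theorem measurable_sdgdGrad2 (hσ : pb.ActivationAssumption) (hop : pb.OperatorAssumption)
    {b k j : ℕ} : Measurable (Function.uncurry (pb.sdgdGrad2 (b := b) (k := k) (j := j))) := by
  refine measurable_from_prod_countable_left fun ξ => ?_
  have hr (r : Fin pb.numPoints) : Measurable fun θ => (pb.numTerms : ℝ) / j *
      (∑ e, pb.term (ξ.2.2 e) θ (pb.point r)) - pb.rhs (pb.point r) :=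
    ((Finset.measurable_fun_sum _ fun e _ =>
      measurable_term hσ hop _ (pb.point_mem r)).const_mul _).sub_const _
  have hc (r : Fin pb.numPoints) :
      Measurable fun θ => ∑ c, pb.termGrad (ξ.2.1 c) θ (pb.point r) :=
    Finset.measurable_fun_sum _ fun c _ => measurable_termGrad _ _
  have h : Measurable fun θ => ∑ a, ((pb.numTerms : ℝ) / j *
      (∑ e, pb.term (ξ.2.2 e) θ (pb.point (ξ.1 a))) - pb.rhs (pb.point (ξ.1 a))) •
      ∑ c, pb.termGrad (ξ.2.1 c) θ (pb.point (ξ.1 a)) :=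
    Finset.measurable_fun_sum _ fun a _ => (hr (ξ.1 a)).smul (hc (ξ.1 a))
  exact h.const_smul (1 / ((b : ℝ) * k * pb.numTerms))

theorem exists_norm_sdgdGrad1_le (hσ : pb.ActivationAssumption) (hop : pb.OperatorAssumption)
    (b k : ℕ) {K : Set A.Param} (hK : IsCompact K) :
    ∃ G : ℝ, ∀ θ ∈ K, ∀ ξ, ‖pb.sdgdGrad1 (b := b) (k := k) θ ξ‖ ≤ G := by
  choose T hT using fun i r => exists_abs_term_le hσ hop i (pb.point_mem r) hK
  choose M hM using fun i r => exists_norm_termGrad_le hσ hop i (pb.point_mem r) hK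
  have (ξ : (Fin b → Fin pb.numPoints) × (Fin k → Fin pb.numTerms)) :
      ∃ G : ℝ, ∀ θ ∈ K, ‖pb.sdgdGrad1 θ ξ‖ ≤ G := by
    refine ⟨_, fun θ hθ => (norm_smul_le _ _).trans (mul_le_mul_of_nonneg_left
      (norm_sum_le_of_le _ fun a _ => (norm_smul_le _ _).trans (mul_le_mul
        ((norm_sub_le _ _).trans (add_le_add (norm_sum_le_of_le _ fun i _ =>
          hT i (ξ.1 a) θ hθ) le_rfl))
        (norm_sum_le_of_le _ fun c _ => hM (ξ.2 c) (ξ.1 a) θ hθ) (norm_nonneg _) ?_))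
      (norm_nonneg _))⟩
    exact add_nonneg (Finset.sum_nonneg fun i _ => (abs_nonneg _).trans (hT i (ξ.1 a) θ hθ))
      (norm_nonneg _)
  -- There are finitely many samples, so the bounds for each have a common one.
  choose G hG using this
  obtain ⟨G', hG'⟩ := (Set.finite_range G).bddAbove
  exact ⟨G', fun θ hθ ξ => (hG ξ θ hθ).trans (hG' (Set.mem_range_self ξ))⟩

theorem exists_norm_sdgdGrad2_le (hσ : pb.ActivationAssumption) (hop : pb.OperatorAssumption)
    (b k j : ℕ) {K : Set A.Param} (hK : IsCompact K) :
    ∃ G : ℝ, ∀ θ ∈ K, ∀ ξ, ‖pb.sdgdGrad2 (b := b) (k := k) (j := j) θ ξ‖ ≤ G := by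
  choose T hT using fun i r => exists_abs_term_le hσ hop i (pb.point_mem r) hK
  choose M hM using fun i r => exists_norm_termGrad_le hσ hop i (pb.point_mem r) hK
  have (ξ : (Fin b → Fin pb.numPoints) × (Fin k → Fin pb.numTerms) × (Fin j → Fin pb.numTerms)) :
      ∃ G : ℝ, ∀ θ ∈ K, ‖pb.sdgdGrad2 θ ξ‖ ≤ G := by
    refine ⟨_, fun θ hθ => (norm_smul_le _ _).trans (mul_le_mul_of_nonneg_left
      (norm_sum_le_of_le _ fun a _ => (norm_smul_le _ _).trans (mul_le_mul
        ((norm_sub_le _ _).trans (add_le_add ((norm_mul_le _ _).trans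
          (mul_le_mul_of_nonneg_left (norm_sum_le_of_le _ fun e _ =>
          hT (ξ.2.2 e) (ξ.1 a) θ hθ) (norm_nonneg _))) le_rfl))
        (norm_sum_le_of_le _ fun c _ => hM (ξ.2.1 c) (ξ.1 a) θ hθ) (norm_nonneg _) ?_))
      (norm_nonneg _))⟩
    exact add_nonneg (mul_nonneg (norm_nonneg _) (Finset.sum_nonneg fun e _ =>
      (abs_nonneg _).trans (hT (ξ.2.2 e) (ξ.1 a) θ hθ))) (norm_nonneg _)
  choose G hG using this
  obtain ⟨G', hG'⟩ := (Set.finite_range G).bddAbove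
  exact ⟨G', fun θ hθ ξ => (hG ξ θ hθ).trans (hG' (Set.mem_range_self ξ))⟩

end Problem

/-! ### Independence of the past and integration over the fresh sample. -/

/-- In terms of laws this is associativity of the product measure. It joins the independence of the
initial value from all samples to the independence of the samples among themselves. -/
theorem indepFun_prodMk_left {Ω α β τ : Type*} [MeasurableSpace Ω] [MeasurableSpace α]
    [MeasurableSpace β] [MeasurableSpace τ] {P : Measure Ω} [IsFiniteMeasure P]
    {X : Ω → α} {Y : Ω → β} {Z : Ω → τ} (hX : Measurable X) (hY : Measurable Y)
    (hZ : Measurable Z) (h : IndepFun X (fun ω => (Y ω, Z ω)) P) (hYZ : IndepFun Y Z P) :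
    IndepFun (fun ω => (X ω, Y ω)) Z P := by
  have hXY : IndepFun X Y P := h.comp measurable_id measurable_fst
  rw [indepFun_iff_map_prod_eq_prod_map_map (by fun_prop) (by fun_prop)] at *
  rw [hXY, ← MeasurableEquiv.prodAssoc.map_measurableEquiv_injective.eq_iff,
    Measure.prodAssoc_prod, ← hYZ, ← h, Measure.map_map (by fun_prop) (by fun_prop)]
  rfl

theorem integral_comp_of_indepFun {Ω α S : Type*} [MeasurableSpace Ω] [MeasurableSpace α]
    [MeasurableSpace S] {P : Measure Ω} [IsFiniteMeasure P] {V : Ω → α} {Z : Ω → S}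
    (hV : Measurable V) (hZ : Measurable Z) (h : IndepFun V Z P) {ψ : α × S → ℝ}
    (hψ : Measurable ψ) {M : ℝ} (hM : ∀ q, ‖ψ q‖ ≤ M) :
    ∫ ω, ψ (V ω, Z ω) ∂P = ∫ ω, ∫ s, ψ (V ω, s) ∂P.map Z ∂P := by
  have hVZ := (indepFun_iff_map_prod_eq_prod_map_map hV.aemeasurable hZ.aemeasurable).1 h
  rw [← integral_map (φ := fun ω => (V ω, Z ω)) (by fun_prop) hψ.aestronglyMeasurable, hVZ,
    integral_prod _ (.of_bound hψ.aestronglyMeasurable M (.of_forall hM)),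
    integral_map (by fun_prop)]
  exact hψ.stronglyMeasurable.integral_prod_right'.aestronglyMeasurable

namespace IsSGD

/-- The initial value and the samples of the first `N` steps. -/
def history {Ω S Θ : Type*} (ξ : ℕ → Ω → S) (θ : ℕ → Ω → Θ) (N : ℕ) (ω : Ω) : Θ × (Finset.range N → S) :=
  (θ 0 ω, fun i => ξ i ω)

/-- The event that the trajectory starts in `U₁` and that the iterates `0, …, n` lie in `U`. -/
def confined {Ω Θ : Type*} (θ : ℕ → Ω → Θ) (U₁ U : Set Θ) (n : ℕ) : Set Ω :=
  {ω | θ 0 ω ∈ U₁ ∧ ∀ i ≤ n, θ i ω ∈ U}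

theorem confined_anti {Ω Θ : Type*} (θ : ℕ → Ω → Θ) (U₁ U : Set Θ) :
    Antitone (confined θ U₁ U) :=
  fun _ _ hmn _ hω => ⟨hω.1, fun i hi => hω.2 i (hi.trans hmn)⟩

variable {Ω S Θ : Type*} [MeasurableSpace Ω] [MeasurableSpace S]
  [NormedAddCommGroup Θ] [InnerProductSpace ℝ Θ] [MeasurableSpace Θ]
  {P : Measure Ω} {ν : Measure S} {g : Θ → S → Θ} {γ : ℕ → ℝ}
  {ξ : ℕ → Ω → S} {θ : ℕ → Ω → Θ}

theorem measurable_history (h : IsSGD P ν g γ ξ θ) (N : ℕ) : Measurable (history ξ θ N) :=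
  h.measurable_init.prodMk (measurable_pi_lambda _ fun i => h.measurable_sample i)

theorem indepFun_history [IsProbabilityMeasure P] (h : IsSGD P ν g γ ξ θ) (N : ℕ) :
    IndepFun (history ξ θ N) (ξ N) P := by
  refine indepFun_prodMk_left h.measurable_init
    (measurable_pi_lambda _ fun i => h.measurable_sample i) (h.measurable_sample N) ?_ ?_
  · exact h.indep_init.comp measurable_id
      ((measurable_pi_lambda _ fun i => measurable_pi_apply _).prodMk (measurable_pi_apply N) :
        Measurable fun x : ℕ → S => ((fun i : Finset.range N => x i), x N))
  · have hd : Disjoint (Finset.range N) {N} := by simp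
    exact (h.indep_samples.indepFun_finset (Finset.range N) {N} hd h.measurable_sample).comp
      measurable_id (measurable_pi_apply (⟨N, by simp⟩ : ({N} : Finset ℕ)))

variable [BorelSpace Θ] [SecondCountableTopology Θ]

/-- Unrolling the recursion: the iterates up to N are deterministic functions of the history, so
events about them are independent of the sample N. -/
theorem exists_measurable_history (h : IsSGD P ν g γ ξ θ)
    (hg : Measurable (Function.uncurry g)) (N : ℕ) :
    ∀ n ≤ N, ∃ F : Θ × (Finset.range N → S) → Θ, Measurable F ∧
      ∀ ω, θ n ω = F (history ξ θ N ω)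
  | 0, _ => ⟨Prod.fst, measurable_fst, fun _ => rfl⟩
  | n + 1, hn => by
    obtain ⟨F, hF, hF'⟩ := exists_measurable_history h hg N n (Nat.le_of_succ_le hn)
    refine ⟨fun v => F v - γ n • g (F v) (v.2 ⟨n, Finset.mem_range.2 hn⟩), ?_, fun ω => ?_⟩
    · exact hF.sub ((hg.comp (hF.prodMk
        ((measurable_pi_apply _).comp measurable_snd))).const_smul (γ n))
    · rw [h.step, hF']
      rfl

theorem measurable (h : IsSGD P ν g γ ξ θ) (hg : Measurable (Function.uncurry g)) (n : ℕ) :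
    Measurable (θ n) := by
  obtain ⟨F, hF, hF'⟩ := h.exists_measurable_history hg n n le_rfl
  rw [funext hF']
  exact hF.comp (h.measurable_history n)

theorem measurableSet_confined (h : IsSGD P ν g γ ξ θ) (hg : Measurable (Function.uncurry g))
    {U₁ U : Set Θ} (hU₁ : MeasurableSet U₁) (hU : MeasurableSet U) (n : ℕ) :
    MeasurableSet (confined θ U₁ U n) := by
  have : confined θ U₁ U n = θ 0 ⁻¹' U₁ ∩ ⋂ i ≤ n, θ i ⁻¹' U := by
    ext
    simp [confined]
  rw [this]
  exact (h.measurable_init hU₁).inter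
    (.iInter fun i => .iInter fun _ => h.measurable hg i hU)

/-- On an event that is determined by the past, the new sample may be integrated out. -/
theorem setIntegral_confined [IsProbabilityMeasure P] (h : IsSGD P ν g γ ξ θ) (hg : Measurable (Function.uncurry g))
    {U₁ U : Set Θ} (hU₁ : MeasurableSet U₁) (hU : MeasurableSet U) (n : ℕ)
    {q : Θ × S → ℝ} (hq : Measurable q) {M : ℝ} (hM : ∀ x ∈ U, ∀ s, ‖q (x, s)‖ ≤ M) :
    ∫ ω in confined θ U₁ U n, q (θ n ω, ξ n ω) ∂P =
      ∫ ω in confined θ U₁ U n, ∫ s, q (θ n ω, s) ∂ν ∂P := by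
  choose F hF hF' using h.exists_measurable_history hg n
  -- The event `confined`, read off from the history.
  let B : Set (Θ × (Finset.range n → S)) := Prod.fst ⁻¹' U₁ ∩ ⋂ i, ⋂ hi : i ≤ n, F i hi ⁻¹' U
  have hB : MeasurableSet B :=
    (measurable_fst hU₁).inter (.iInter fun i => .iInter fun hi => hF i hi hU)
  have hBU {v} (hv : v ∈ B) : F n le_rfl v ∈ U := by
    have := hv.2
    simp only [Set.mem_iInter, Set.mem_preimage] at this
    exact this n le_rfl
  have hmem (ω : Ω) : ω ∈ confined θ U₁ U n ↔ history ξ θ n ω ∈ B := by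
    simp only [confined, Set.mem_ofPred_eq, B, Set.mem_inter_iff, Set.mem_preimage, Set.mem_iInter,
      ← hF']
    rfl
  have hA := h.measurableSet_confined hg hU₁ hU n
  -- `q` is bounded only over `U`; cutting it off outside `B` makes it bounded everywhere, as Fubini
  -- is applied on the whole space.
  let ψ : (Θ × (Finset.range n → S)) × S → ℝ :=
    (Prod.fst ⁻¹' B).indicator fun z => q (F n le_rfl z.1, z.2)
  have hψ : Measurable ψ := (hq.comp (((hF n le_rfl).comp measurable_fst).prodMk
    measurable_snd)).indicator (measurable_fst hB)
  have hψM (z) : ‖ψ z‖ ≤ max M 0 := by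
    by_cases hz : z ∈ Prod.fst ⁻¹' B
    · rw [show ψ z = _ from Set.indicator_of_mem hz _]
      exact (hM _ (hBU hz) _).trans (le_max_left _ _)
    · rw [show ψ z = _ from Set.indicator_of_notMem hz _, norm_zero]
      exact le_max_right _ _
  have key := integral_comp_of_indepFun (h.measurable_history n) (h.measurable_sample n)
    (h.indepFun_history n) hψ hψM
  rw [h.law_sample] at key
  rw [← integral_indicator hA, ← integral_indicator hA]
  refine Eq.trans (integral_congr_ae (.of_forall fun ω => ?_))
    (key.trans (integral_congr_ae (.of_forall fun ω => ?_)))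
  · by_cases hω : ω ∈ confined θ U₁ U n
    · simp only [Set.indicator_of_mem hω, ψ]
      rw [Set.indicator_of_mem (show _ ∈ Prod.fst ⁻¹' B from (hmem ω).1 hω), ← hF']
    · simp only [Set.indicator_of_notMem hω, ψ]
      rw [Set.indicator_of_notMem (show _ ∉ Prod.fst ⁻¹' B from fun h' => hω ((hmem ω).2 h'))]
  · by_cases hω : ω ∈ confined θ U₁ U n
    · simp only [Set.indicator_of_mem hω, ψ]
      refine integral_congr_ae (.of_forall fun s => ?_)
      change Set.indicator _ _ _ = _
      rw [Set.indicator_of_mem (show _ ∈ Prod.fst ⁻¹' B from (hmem ω).1 hω), ← hF']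
    · simp only [Set.indicator_of_notMem hω, ψ]
      rw [← integral_zero S ℝ (μ := ν)]
      refine integral_congr_ae (.of_forall fun s => ?_)
      change Set.indicator _ _ _ = _
      rw [Set.indicator_of_notMem (show _ ∉ Prod.fst ⁻¹' B from fun h' => hω ((hmem ω).2 h'))]

end IsSGD

/-! ### Deterministic estimates for the step sizes. -/

/-- A recursion with step sizes `γ / (n + 1 + m) ^ p`, where `γ c ≥ 1`. -/
theorem le_div_rpow_of_recursion {c G γ m p K : ℝ} (hp : 0 < p) (hp' : p ≤ 1)
    (hm : 0 < m) (hγ : 1 ≤ c * γ) (hγm : 2 * c * γ ≤ m ^ p) {a : ℕ → ℝ}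
    (h₀ : a 0 ≤ K)
    (ha : ∀ n, a (n + 1) ≤ (1 - 2 * c * (γ / ((n + 1 : ℝ) + m) ^ p)) * a n +
      G ^ 2 * (γ / ((n + 1 : ℝ) + m) ^ p) ^ 2) (n : ℕ) :
    a n ≤ max (γ ^ 2 * G ^ 2) (K * (1 + m) ^ p) / (n + 1 : ℝ) ^ p := by
  set C := max (γ ^ 2 * G ^ 2) (K * (1 + m) ^ p) with hCdef
  have hC₁ : γ ^ 2 * G ^ 2 ≤ C := le_max_left _ _
  have hC : 0 ≤ C := (by positivity : 0 ≤ γ ^ 2 * G ^ 2).trans hC₁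
  -- The induction needs the shifted denominator, in which the step sizes are expressed. The second
  -- entry of `C` is what the case n = 0 requires.
  suffices h : a n ≤ C / ((n + 1 : ℝ) + m) ^ p by
    refine h.trans (div_le_div_of_nonneg_left hC (by positivity) ?_)
    exact Real.rpow_le_rpow (by positivity) (by linarith) hp.le
  induction n with
  | zero =>
    simp only [CharP.cast_eq_zero, zero_add]
    rw [le_div_iff₀ (by positivity)]
    exact (mul_le_mul_of_nonneg_right h₀ (by positivity)).trans (le_max_right _ _)
  | succ n ih =>
    set t : ℝ := (n + 1 : ℝ) + m with ht
    have ht₁ : 1 ≤ t := by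
      have : (0 : ℝ) ≤ n := n.cast_nonneg
      linarith
    have ht₀ : 0 < t := by linarith
    set T := t ^ p with hT
    have hT₀ : 0 < T := Real.rpow_pos_of_pos ht₀ p
    have hTt : T ≤ t := by
      simpa using Real.rpow_le_rpow_of_exponent_le ht₁ hp'
    have hmT : m ^ p ≤ T := Real.rpow_le_rpow hm.le (by
      have : (0 : ℝ) ≤ n := n.cast_nonneg
      linarith) hp.le
    have hstep : 0 ≤ 1 - 2 * c * (γ / T) := by
      rw [← mul_div_assoc, sub_nonneg, div_le_one hT₀]
      exact hγm.trans hmT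
    -- A relative decrease by 1 / T suffices to reach the next bound: since p ≤ 1, both T ≤ t and (1
    -- + 1 / t) ^ p ≤ 1 + 1 / t hold.
    have hlow : C / T * (1 - 1 / T) ≤ C / (t + 1) ^ p := by
      have h₁ : (t + 1) ^ p ≤ T * (1 + 1 / t) := by
        have : t + 1 = t * (1 + 1 / t) := by field_simp
        rw [this, Real.mul_rpow ht₀.le (by positivity)]
        refine mul_le_mul_of_nonneg_left ?_ hT₀.le
        have h1 : 1 ≤ 1 + 1 / t := by
          have : 0 ≤ 1 / t := by positivity
          linarith
        simpa using Real.rpow_le_rpow_of_exponent_le h1 hp'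
      have h₂ : 1 - 1 / T ≤ 1 - 1 / t := by
        have := one_div_le_one_div_of_le hT₀ hTt
        linarith
      have h₃ : (1 - 1 / t) * (1 + 1 / t) ≤ 1 := by nlinarith [sq_nonneg (1 / t)]
      have h₄ : 0 ≤ 1 - 1 / t := by
        rw [sub_nonneg, div_le_one ht₀]
        exact ht₁
      rw [le_div_iff₀ (by positivity)]
      calc C / T * (1 - 1 / T) * (t + 1) ^ p ≤ C / T * (1 - 1 / t) * (T * (1 + 1 / t)) := by
            gcongr
        _ = C * ((1 - 1 / t) * (1 + 1 / t)) := by field_simp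
        _ ≤ C * 1 := mul_le_mul_of_nonneg_left h₃ hC
        _ = C := mul_one C
    have hsucc : ((n + 1 : ℕ) + 1 : ℝ) + m = t + 1 := by
      push_cast
      ring
    rw [hsucc]
    refine (ha n).trans (le_trans ?_ hlow)
    have h₅ := mul_le_mul_of_nonneg_left ih hstep
    -- As cγ ≥ 1, the contraction gains at least 2C / T²: one half is the required decrease, the
    -- other absorbs the noise γ²G² / T² ≤ C / T².
    have h₆ : (1 - 2 * c * (γ / T)) * (C / T) + G ^ 2 * (γ / T) ^ 2 ≤ C / T * (1 - 1 / T) := by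
      have : C / T * (1 - 1 / T) - ((1 - 2 * c * (γ / T)) * (C / T) + G ^ 2 * (γ / T) ^ 2) =
          (C * (2 * (c * γ) - 1) - γ ^ 2 * G ^ 2) / T ^ 2 := by
        field_simp
        ring
      have h₇ : 0 ≤ C * (2 * (c * γ) - 1) - γ ^ 2 * G ^ 2 := by nlinarith
      have := div_nonneg h₇ (sq_nonneg T)
      linarith
    linarith

/-- The squares of the step sizes have a small sum if `m` is large. -/
theorem exists_sum_sq_step_le {p : ℝ} (hp : 1 / 2 < p) (γ : ℝ) {ε : ℝ} (hε : 0 < ε) :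
    ∃ M : ℝ, ∀ m ≥ M, ∀ N : ℕ,
      ∑ n ∈ Finset.range N, (γ / ((n + 1 : ℝ) + m) ^ p) ^ 2 ≤ ε := by
  have hs : Summable fun n : ℕ => γ ^ 2 * (1 / (n : ℝ) ^ (2 * p)) :=
    (Real.summable_one_div_nat_rpow.2 (by linarith)).mul_left _
  -- The tails of ∑ n^{-2p} tend to zero, and a shift by m ≥ M is dominated by the tail from M on.
  -- The condition 1 ≤ M keeps the bases positive.
  obtain ⟨M, hM, hM₁⟩ := (((tendsto_sum_nat_add
    fun n : ℕ => γ ^ 2 * (1 / (n : ℝ) ^ (2 * p))).eventually (gt_mem_nhds hε)).and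
      (Filter.eventually_ge_atTop 1)).exists
  refine ⟨M, fun m hm N => le_trans ?_ hM.le⟩
  refine le_trans (Finset.sum_le_sum fun n _ => ?_)
    (((summable_nat_add_iff M).2 hs).sum_le_tsum (Finset.range N) fun n _ => by positivity)
  have hpos : 0 < ((n + M : ℕ) : ℝ) := by
    have : 0 < n + M := by omega
    exact_mod_cast this
  have hle : ((n + M : ℕ) : ℝ) ≤ (n + 1 : ℝ) + m := by
    push_cast
    linarith
  rw [div_pow, ← Real.rpow_natCast (((n + 1 : ℝ) + m) ^ p) 2,
    ← Real.rpow_mul (hpos.le.trans hle), mul_one_div, mul_comm p, Nat.cast_ofNat]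
  exact div_le_div_of_nonneg_left (sq_nonneg γ) (Real.rpow_pos_of_pos hpos _)
    (Real.rpow_le_rpow hpos.le hle (by linarith))

/-! ### Stability and mean-square rate near a minimizer. -/

namespace IsSGD

variable {Ω S Θ : Type*} [MeasurableSpace Ω] [MeasurableSpace S]
  [NormedAddCommGroup Θ] [InnerProductSpace ℝ Θ] [MeasurableSpace Θ] [BorelSpace Θ]
  [SecondCountableTopology Θ]
  {P : Measure Ω} [IsProbabilityMeasure P] {ν : Measure S} {g : Θ → S → Θ} {γ : ℕ → ℝ}
  {ξ : ℕ → Ω → S} {θ : ℕ → Ω → Θ} {θs : Θ} {c G r : ℝ} {U₁ : Set Θ}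

theorem integrableOn_confined (h : IsSGD P ν g γ ξ θ) (hg : Measurable (Function.uncurry g))
    (hU₁ : MeasurableSet U₁) (n : ℕ) :
    IntegrableOn (fun ω => ‖θ n ω - θs‖ ^ 2) (confined θ U₁ (Metric.ball θs r) n) P := by
  refine .of_bound (measure_lt_top _ _)
    (((h.measurable hg n).sub_const θs).norm.pow_const 2).aestronglyMeasurable (r ^ 2) ?_
  filter_upwards [ae_restrict_mem (h.measurableSet_confined hg hU₁ measurableSet_ball n)]
    with ω hω
  have := mem_ball_iff_norm.1 (hω.2 n le_rfl)
  rw [norm_pow, norm_norm]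
  gcongr

/-- The new iterate may have left the ball, but by no more than the length of one step. -/
theorem integrableOn_confined_succ (h : IsSGD P ν g γ ξ θ)
    (hg : Measurable (Function.uncurry g)) (hU₁ : MeasurableSet U₁)
    (hG : ∀ x ∈ Metric.ball θs r, ∀ s, ‖g x s‖ ≤ G) (n : ℕ) :
    IntegrableOn (fun ω => ‖θ (n + 1) ω - θs‖ ^ 2) (confined θ U₁ (Metric.ball θs r) n) P := by
  refine .of_bound (measure_lt_top _ _)
    (((h.measurable hg (n + 1)).sub_const θs).norm.pow_const 2).aestronglyMeasurable
    ((r + |γ n| * G) ^ 2) ?_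
  filter_upwards [ae_restrict_mem (h.measurableSet_confined hg hU₁ measurableSet_ball n)]
    with ω hω
  have h₁ := mem_ball_iff_norm.1 (hω.2 n le_rfl)
  have h₂ := hG _ (hω.2 n le_rfl) (ξ n ω)
  rw [norm_pow, norm_norm, h.step, sub_right_comm]
  have h₃ : ‖γ n • g (θ n ω) (ξ n ω)‖ ≤ |γ n| * G := by
    rw [norm_smul, Real.norm_eq_abs]
    gcongr
  have := norm_sub_le (θ n ω - θs) (γ n • g (θ n ω) (ξ n ω))
  gcongr
  linarith

/-- One step of the method contracts the expected squared distance to the minimizer. -/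
theorem setIntegral_confined_succ_le (h : IsSGD P ν g γ ξ θ)
    (hg : Measurable (Function.uncurry g)) (hU₁ : MeasurableSet U₁)
    (hG : ∀ x ∈ Metric.ball θs r, ∀ s, ‖g x s‖ ≤ G)
    (hc : ∀ x ∈ Metric.ball θs r, c * ‖x - θs‖ ^ 2 ≤ ∫ s, inner ℝ (g x s) (x - θs) ∂ν)
    (n : ℕ) (hγ : 0 ≤ γ n) :
    ∫ ω in confined θ U₁ (Metric.ball θs r) n, ‖θ (n + 1) ω - θs‖ ^ 2 ∂P ≤
      (1 - 2 * c * γ n) * ∫ ω in confined θ U₁ (Metric.ball θs r) n, ‖θ n ω - θs‖ ^ 2 ∂P +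
        G ^ 2 * γ n ^ 2 * P.real (confined θ U₁ (Metric.ball θs r) n) := by
  set A := confined θ U₁ (Metric.ball θs r) n with hAdef
  have hA : MeasurableSet A := h.measurableSet_confined hg hU₁ measurableSet_ball n
  have hν : IsProbabilityMeasure ν := by
    rw [← h.law_sample n]
    exact Measure.isProbabilityMeasure_map (h.measurable_sample n).aemeasurable
  let q : Θ × S → ℝ := fun z => inner ℝ (g z.1 z.2) (z.1 - θs)
  have hq : Measurable q := hg.inner (measurable_fst.sub_const θs)
  have hqM : ∀ x ∈ Metric.ball θs r, ∀ s, ‖q (x, s)‖ ≤ G * r := fun x hx s => by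
    refine (norm_inner_le_norm _ _).trans (mul_le_mul (hG x hx s)
      (mem_ball_iff_norm.1 hx).le (norm_nonneg _) ((norm_nonneg _).trans (hG x hx s)))
  have hD := h.integrableOn_confined (θs := θs) (r := r) hg hU₁ n
  have hD' := h.integrableOn_confined_succ hg hU₁ hG n
  have hθ := h.measurable hg n
  have hqi : IntegrableOn (fun ω => q (θ n ω, ξ n ω)) A P := by
    refine .of_bound (measure_lt_top _ _)
      (hq.comp (hθ.prodMk (h.measurable_sample n))).aestronglyMeasurable (G * r) ?_
    filter_upwards [ae_restrict_mem hA] with ω hω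
    exact hqM _ (hω.2 n le_rfl) _
  have hqi' : IntegrableOn (fun ω => ∫ s, q (θ n ω, s) ∂ν) A P := by
    refine .of_bound (measure_lt_top _ _)
      (hq.stronglyMeasurable.integral_prod_right'.comp_measurable hθ).aestronglyMeasurable
      (G * r) ?_
    filter_upwards [ae_restrict_mem hA] with ω hω
    simpa using norm_integral_le_of_norm_le_const (μ := ν)
      (.of_forall fun s => hqM _ (hω.2 n le_rfl) s)
  -- Integrating out the fresh sample replaces the stochastic gradient by its mean, to which the
  -- coercivity applies pointwise.
  have hmean : c * ∫ ω in A, ‖θ n ω - θs‖ ^ 2 ∂P ≤ ∫ ω in A, q (θ n ω, ξ n ω) ∂P := by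
    rw [h.setIntegral_confined hg hU₁ measurableSet_ball n hq hqM, ← integral_const_mul]
    exact setIntegral_mono_on (hD.const_mul c) hqi' hA fun ω hω => hc _ (hω.2 n le_rfl)
  have hle : ∫ ω in A, ‖θ (n + 1) ω - θs‖ ^ 2 ∂P ≤
      ∫ ω in A, (‖θ n ω - θs‖ ^ 2 - 2 * γ n * q (θ n ω, ξ n ω) + G ^ 2 * γ n ^ 2) ∂P := by
    refine setIntegral_mono_on hD' ((hD.sub (hqi.const_mul _)).add
      (integrableOn_const (measure_ne_top _ _))) hA fun ω hω => ?_
    have h₂ := hG _ (hω.2 n le_rfl) (ξ n ω)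
    rw [h.step, sub_right_comm, norm_sub_sq_real, norm_smul, inner_smul_right, real_inner_comm,
      mul_pow, Real.norm_eq_abs, sq_abs]
    have : γ n ^ 2 * ‖g (θ n ω) (ξ n ω)‖ ^ 2 ≤ γ n ^ 2 * G ^ 2 := by gcongr
    simp only [q]
    linarith
  refine hle.trans ?_
  have hDq : IntegrableOn (fun ω => ‖θ n ω - θs‖ ^ 2 - 2 * γ n * q (θ n ω, ξ n ω)) A P :=
    hD.sub (hqi.const_mul _)
  rw [integral_add hDq (integrableOn_const (measure_ne_top _ _)),
    integral_sub hD (hqi.const_mul _), integral_const_mul, setIntegral_const, smul_eq_mul]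
  have := mul_le_mul_of_nonneg_left hmean hγ
  linarith

/-- A trajectory started close to a minimizer stays close with high probability, and then it
converges in mean square. -/
theorem local_convergence (h : IsSGD P ν g γ ξ θ)
    (hg : Measurable (Function.uncurry g)) (hc₀ : 0 ≤ c) (hr : 0 < r)
    (hG : ∀ x ∈ Metric.ball θs r, ∀ s, ‖g x s‖ ≤ G)
    (hc : ∀ x ∈ Metric.ball θs r, c * ‖x - θs‖ ^ 2 ≤ ∫ s, inner ℝ (g x s) (x - θs) ∂ν)
    (hγ : ∀ n, 0 ≤ γ n) {r₁ δ : ℝ} (hr₁ : r₁ ≤ r) (hδ : δ ≤ 1 / 2)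
    (hsum : ∀ N, r₁ ^ 2 + G ^ 2 * ∑ n ∈ Finset.range N, γ n ^ 2 ≤ δ * r ^ 2)
    {b : ℕ → ℝ}
    (hb : ∀ a : ℕ → ℝ, a 0 ≤ r ^ 2 →
      (∀ n, a (n + 1) ≤ (1 - 2 * c * γ n) * a n + G ^ 2 * γ n ^ 2) → ∀ n, a n ≤ b n)
    (hP : P {ω | θ 0 ω ∈ Metric.ball θs r₁} ≠ 0) :
    1 - δ ≤ (P[|{ω | θ 0 ω ∈ Metric.ball θs r₁}]).real {ω | ∀ n, θ n ω ∈ Metric.ball θs r} ∧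
    ∀ n : ℕ,
      Integrable (fun ω => ‖θ n ω - θs‖ ^ 2)
        (P[|{ω | θ 0 ω ∈ Metric.ball θs r₁} ∩ {ω | ∀ n, θ n ω ∈ Metric.ball θs r}]) ∧
      ∫ ω, ‖θ n ω - θs‖ ^ 2
        ∂(P[|{ω | θ 0 ω ∈ Metric.ball θs r₁} ∩ {ω | ∀ n, θ n ω ∈ Metric.ball θs r}]) ≤
        2 * b n := by
  set A := confined θ (Metric.ball θs r₁) (Metric.ball θs r) with hAdef
  have hA (n : ℕ) : MeasurableSet (A n) :=
    h.measurableSet_confined hg measurableSet_ball measurableSet_ball n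
  have hAanti : Antitone A := confined_anti θ _ _
  have hA₀ : A 0 = {ω | θ 0 ω ∈ Metric.ball θs r₁} := by
    ext ω
    refine ⟨fun hω => hω.1, fun hω => ⟨hω, fun i hi => ?_⟩⟩
    rw [Nat.le_zero.1 hi]
    exact Metric.ball_subset_ball hr₁ hω
  have hE : {ω | θ 0 ω ∈ Metric.ball θs r₁} ∩ {ω | ∀ n, θ n ω ∈ Metric.ball θs r} = ⋂ n, A n := by
    ext ω
    simp only [Set.mem_inter_iff, Set.mem_iInter]
    exact ⟨fun hω n => ⟨hω.1, fun i _ => hω.2 i⟩, fun hω => ⟨(hω 0).1, fun n => (hω n).2 n le_rfl⟩⟩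
  have hEm : MeasurableSet (⋂ n, A n) := .iInter hA
  let mass : ℝ := P.real (A 0)
  have hmass : 0 < mass := by
    refine ENNReal.toReal_pos ?_ (measure_ne_top _ _)
    rwa [hA₀]
  let a : ℕ → ℝ := fun n => ∫ ω in A n, ‖θ n ω - θs‖ ^ 2 ∂P
  have ha₀ (n : ℕ) : 0 ≤ a n := integral_nonneg fun ω => by positivity
  have hreal (n : ℕ) : P.real (A n) ≤ mass := measureReal_mono (hAanti n.zero_le)
  have hstep (n : ℕ) : r ^ 2 * (P.real (A n) - P.real (A (n + 1))) + a (n + 1) ≤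
      (1 - 2 * c * γ n) * a n + G ^ 2 * γ n ^ 2 * mass := by
    have h₁ := h.setIntegral_confined_succ_le hg (U₁ := Metric.ball θs r₁) measurableSet_ball
      hG hc n (hγ n)
    have h₂ := h.integrableOn_confined_succ hg (U₁ := Metric.ball θs r₁) measurableSet_ball hG n
    have h₃ := setIntegral_sdiff (hA (n + 1)) h₂ (hAanti n.le_succ)
    -- Where the trajectory escapes at this step, the new iterate is at distance at least r.
    have h₄ : r ^ 2 * P.real (A n \ A (n + 1)) ≤
        ∫ ω in A n \ A (n + 1), ‖θ (n + 1) ω - θs‖ ^ 2 ∂P := by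
      have h₅ : ∫ ω in A n \ A (n + 1), r ^ 2 ∂P = r ^ 2 * P.real (A n \ A (n + 1)) := by
        rw [setIntegral_const, smul_eq_mul, mul_comm]
      rw [← h₅]
      refine setIntegral_mono_on (integrableOn_const (measure_ne_top _ _))
        (h₂.mono_set Set.sdiff_subset) ((hA n).diff (hA (n + 1))) fun ω hω => ?_
      have : θ (n + 1) ω ∉ Metric.ball θs r := fun hmem => hω.2 ⟨hω.1.1, fun i hi => by
        rcases Nat.le_succ_iff.1 hi with hi | rfl
        · exact hω.1.2 i hi
        · exact hmem⟩
      rw [mem_ball_iff_norm, not_lt] at this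
      gcongr
    rw [measureReal_sdiff (hAanti n.le_succ) (hA (n + 1))] at h₄
    have h₆ : G ^ 2 * γ n ^ 2 * P.real (A n) ≤ G ^ 2 * γ n ^ 2 * mass :=
      mul_le_mul_of_nonneg_left (hreal n) (by positivity)
    change ∫ ω in A n, ‖θ (n + 1) ω - θs‖ ^ 2 ∂P ≤
      (1 - 2 * c * γ n) * a n + G ^ 2 * γ n ^ 2 * P.real (A n) at h₁
    change _ = _ - a (n + 1) at h₃
    linarith
  have hinit {ρ : ℝ} (hρ : r₁ ≤ ρ) : a 0 ≤ ρ ^ 2 * mass := by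
    have : ρ ^ 2 * mass = ∫ ω in A 0, ρ ^ 2 ∂P := by
      rw [setIntegral_const, smul_eq_mul, mul_comm]
    rw [this]
    refine setIntegral_mono_on (h.integrableOn_confined hg measurableSet_ball 0)
      (integrableOn_const (measure_ne_top _ _)) (hA 0) fun ω hω => ?_
    have := (mem_ball_iff_norm.1 hω.1).le.trans hρ
    gcongr
  -- Here the contraction is discarded, so that the lost masses telescope.
  have hescape (n : ℕ) : r ^ 2 * (mass - P.real (A n)) + a n ≤
      (r₁ ^ 2 + G ^ 2 * ∑ i ∈ Finset.range n, γ i ^ 2) * mass := by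
    induction n with
    | zero => simpa [mass] using hinit le_rfl
    | succ n ih =>
      have := hstep n
      have h₇ : 0 ≤ 2 * c * γ n * a n :=
        mul_nonneg (mul_nonneg (by positivity) (hγ n)) (ha₀ n)
      rw [Finset.sum_range_succ]
      linarith
  have hstay (n : ℕ) : (1 - δ) * mass ≤ P.real (A n) := by
    have h₁ := hescape n
    have h₂ := mul_le_mul_of_nonneg_right (hsum n) hmass.le
    have h₃ : r ^ 2 * (mass - P.real (A n)) ≤ r ^ 2 * (δ * mass) := by
      have := ha₀ n
      linarith
    have := le_of_mul_le_mul_left h₃ (by positivity)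
    linarith
  have hlim : (1 - δ) * mass ≤ P.real (⋂ n, A n) := by
    have := tendsto_measure_iInter_atTop (μ := P) (fun n => (hA n).nullMeasurableSet) hAanti
      ⟨0, measure_ne_top _ _⟩
    exact ge_of_tendsto' ((ENNReal.tendsto_toReal (measure_ne_top _ _)).comp this) hstay
  -- Now the escape term is discarded and the contraction kept; dividing by `mass` normalizes the
  -- recursion for `hb`.
  have hrate (n : ℕ) : a n ≤ b n * mass := by
    rw [← div_le_iff₀ hmass]
    refine hb (fun n => a n / mass) ?_ (fun n => ?_) n
    · rw [div_le_iff₀ hmass]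
      exact hinit hr₁
    · rw [div_le_iff₀ hmass, add_mul, mul_assoc, div_mul_cancel₀ _ hmass.ne']
      have h₁ : 0 ≤ r ^ 2 * (P.real (A n) - P.real (A (n + 1))) :=
        mul_nonneg (sq_nonneg r) (sub_nonneg.2 (measureReal_mono (hAanti n.le_succ)))
      linarith [hstep n]
  refine ⟨?_, fun n => ?_⟩
  · rw [Measure.real, cond_apply (hA₀ ▸ hA 0), hE, ← hA₀, ENNReal.toReal_mul,
      ENNReal.toReal_inv]
    change _ ≤ mass⁻¹ * P.real (⋂ n, A n)
    rw [le_inv_mul_iff₀ hmass, mul_comm]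
    exact hlim
  · have hsub : (⋂ n, A n) ⊆ A n := Set.iInter_subset A n
    have hint := h.integrableOn_confined (θs := θs) (r := r) (U₁ := Metric.ball θs r₁) hg
      measurableSet_ball n
    have hEpos : 0 < P.real (⋂ n, A n) := lt_of_lt_of_le (by nlinarith) hlim
    have hEne : P (⋂ n, A n) ≠ 0 := fun h0 => by simp [Measure.real, h0] at hEpos
    rw [hE]
    refine ⟨(hint.mono_set hsub).smul_measure (ENNReal.inv_ne_top.2 hEne), ?_⟩
    have h₁ : ∫ ω in ⋂ n, A n, ‖θ n ω - θs‖ ^ 2 ∂P ≤ a n :=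
      setIntegral_mono_set hint (.of_forall fun ω => by positivity) hsub.eventuallyLE
    have hb₀ : 0 ≤ b n := nonneg_of_mul_nonneg_left ((ha₀ n).trans (hrate n)) hmass
    rw [ProbabilityTheory.cond, integral_smul_measure, ENNReal.toReal_inv, smul_eq_mul]
    change (P.real (⋂ n, A n))⁻¹ * _ ≤ _
    rw [inv_mul_le_iff₀ hEpos]
    -- This is where δ ≤ 1 / 2 enters and the factor 2 in the bound arises.
    have h₂ : mass / 2 ≤ P.real (⋂ n, A n) := by nlinarith
    have h₃ := mul_le_mul_of_nonneg_right h₂ hb₀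
    linarith [hrate n]

end IsSGD

/-! ### Coercivity of the gradient at a regular minimizer. -/

/-- A positive definite continuous bilinear form in finite dimensions is coercive. -/
theorem exists_pos_mul_sq_le_inner {E : Type*} [NormedAddCommGroup E] [InnerProductSpace ℝ E]
    [FiniteDimensional ℝ E] (H : E →L[ℝ] E) (hH : ∀ v, v ≠ 0 → 0 < inner ℝ (H v) v) :
    ∃ c > (0 : ℝ), ∀ v, c * ‖v‖ ^ 2 ≤ inner ℝ (H v) v := by
  rcases (Metric.sphere (0 : E) 1).eq_empty_or_nonempty with he | hne
  -- The unit sphere is empty only if the space is trivial, and then any constant works.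
  · refine ⟨1, one_pos, fun v => ?_⟩
    by_cases hv : v = 0
    · simp [hv]
    · have : (‖v‖⁻¹ : ℝ) • v ∈ Metric.sphere (0 : E) 1 := by
        simp [norm_smul, inv_mul_cancel₀ (norm_ne_zero_iff.2 hv)]
      simp [he] at this
  · have hcont : Continuous fun v : E => inner ℝ (H v) v := H.continuous.inner continuous_id
    obtain ⟨w, hw, hmin⟩ := (isCompact_sphere (0 : E) 1).exists_isMinOn hne hcont.continuousOn
    have hw0 : w ≠ 0 := fun h => by simp [h] at hw
    refine ⟨_, hH w hw0, fun v => ?_⟩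
    by_cases hv : v = 0
    · simp [hv]
    · have hn : ‖v‖ ≠ 0 := norm_ne_zero_iff.2 hv
      have hs : (‖v‖⁻¹ : ℝ) • v ∈ Metric.sphere (0 : E) 1 := by
        simp [norm_smul, inv_mul_cancel₀ hn]
      have h := hmin hs
      simp only [Set.mem_ofPred_eq, map_smul, real_inner_smul_left, real_inner_smul_right] at h
      calc inner ℝ (H w) w * ‖v‖ ^ 2
          ≤ ‖v‖⁻¹ * (‖v‖⁻¹ * inner ℝ (H v) v) * ‖v‖ ^ 2 := by gcongr
        _ = inner ℝ (H v) v := by field_simp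

/-- A vector field with a zero at which the derivative is positive definite points away from
that zero. -/
theorem exists_ball_mul_sq_le_inner {E : Type*} [NormedAddCommGroup E] [InnerProductSpace ℝ E]
    [FiniteDimensional ℝ E] {F : E → E} {x₀ : E} (hF : DifferentiableAt ℝ F x₀) (h₀ : F x₀ = 0)
    (hpos : ∀ v, v ≠ 0 → 0 < inner ℝ (fderiv ℝ F x₀ v) v) :
    ∃ c > (0 : ℝ), ∃ r > (0 : ℝ), ∀ x ∈ Metric.ball x₀ r,
      c * ‖x - x₀‖ ^ 2 ≤ inner ℝ (F x) (x - x₀) := by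
  obtain ⟨c, hc, hcH⟩ := exists_pos_mul_sq_le_inner _ hpos
  -- Half of the coercivity constant is given up to absorb the linearization error.
  have ho := (hasFDerivAt_iff_isLittleO.1 hF.hasFDerivAt).def (half_pos hc)
  obtain ⟨r, hr, hball⟩ := Metric.eventually_nhds_iff_ball.1 ho
  refine ⟨c / 2, half_pos hc, r, hr, fun x hx => ?_⟩
  have h₁ := hball x hx
  rw [h₀, sub_zero] at h₁
  have h₂ := (abs_le.1 (abs_real_inner_le_norm (F x - fderiv ℝ F x₀ (x - x₀)) (x - x₀))).1
  rw [inner_sub_left] at h₂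
  have h₃ := mul_le_mul_of_nonneg_right h₁ (norm_nonneg (x - x₀))
  linarith [hcH (x - x₀)]

theorem Problem.IsRegularMinimizer.exists_ball {A : Architecture} {pb : Problem A} {θs : A.Param}
    (h : pb.IsRegularMinimizer θs) :
    ∃ c > (0 : ℝ), ∃ r > (0 : ℝ), ∀ x ∈ Metric.ball θs r,
      c * ‖x - θs‖ ^ 2 ≤ inner ℝ (gradient pb.loss x) (x - θs) :=
  exists_ball_mul_sq_le_inner h.differentiableAt_gradient
    (by rw [gradient, h.isLocalMin.fderiv_eq_zero, map_zero]) h.hessian_pos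

end SDGD

/-! ### Choice of the constants and conclusion for both algorithms. -/

theorem theorem3 {A : SDGD.Architecture} (pb : SDGD.Problem A)
    (hσ : pb.ActivationAssumption) (hop : pb.OperatorAssumption)
    (θs : A.Param) (hθs : pb.IsRegularMinimizer θs)
    (sp st : SDGD.Sampling) (b k j : ℕ) (hb : 0 < b) (hk : 0 < k) (hj : 0 < j)
    (p : ℝ) (hp : 1 / 2 < p) (hp' : p ≤ 1) (δ : ℝ) (hδ : 0 < δ) :
    ∃ γ₀ > (0 : ℝ), ∀ γ ≥ γ₀, ∃ m₀ > (0 : ℝ), ∀ m ≥ m₀,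
      ∃ U U₁ : Set A.Param, IsOpen U ∧ θs ∈ U ∧ IsOpen U₁ ∧ θs ∈ U₁ ∧
      ∃ C : ℝ, ∀ {Ω : Type*} [MeasurableSpace Ω] (P : Measure Ω) [IsProbabilityMeasure P]
        (θ : ℕ → Ω → A.Param),
        (pb.IsTrajectory1 P sp st b k (fun n => γ / ((n + 1 : ℝ) + m) ^ p) θ ∨
          pb.IsTrajectory2 P sp st b k j (fun n => γ / ((n + 1 : ℝ) + m) ^ p) θ) →
        SDGD.IsBoundedTrajectory P θ →
        P {ω | θ 0 ω ∈ U₁} ≠ 0 →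
        1 - δ ≤ (P[|{ω | θ 0 ω ∈ U₁}]).real {ω | ∀ n, θ n ω ∈ U} ∧
        ∀ n : ℕ,
          Integrable (fun ω => ‖θ n ω - θs‖ ^ 2)
            (P[|{ω | θ 0 ω ∈ U₁} ∩ {ω | ∀ n, θ n ω ∈ U}]) ∧
          ∫ ω, ‖θ n ω - θs‖ ^ 2 ∂(P[|{ω | θ 0 ω ∈ U₁} ∩ {ω | ∀ n, θ n ω ∈ U}])
            ≤ C / (n + 1 : ℝ) ^ p := by
  obtain ⟨c, hc, r, hr, hmono⟩ := hθs.exists_ball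
  obtain ⟨G₁, hG₁⟩ := SDGD.Problem.exists_norm_sdgdGrad1_le hσ hop b k
    (isCompact_closedBall θs r)
  obtain ⟨G₂, hG₂⟩ := SDGD.Problem.exists_norm_sdgdGrad2_le hσ hop b k j
    (isCompact_closedBall θs r)
  set G := max G₁ G₂
  have hp₀ : 0 < p := by linarith
  -- A smaller δ strengthens the claim, and `local_convergence` requires at most 1 / 2.
  set δ' := min δ (1 / 2)
  have hδ' : 0 < δ' := lt_min hδ (by norm_num)
  refine ⟨1 / c, by positivity, fun γ hγ => ?_⟩
  have hγ₀ : 0 < γ := lt_of_lt_of_le (by positivity) hγ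
  have hcγ : 1 ≤ c * γ := by
    rwa [ge_iff_le, div_le_iff₀' hc] at hγ
  -- The escape budget δ' r² is split evenly between the noise, bounded here, and the initial
  -- distance, which fixes `r₁` below. The summand 1 avoids division by zero.
  have hε : 0 < δ' * r ^ 2 / (2 * (G ^ 2 + 1)) := by positivity
  obtain ⟨M, hM⟩ := SDGD.exists_sum_sq_step_le hp γ hε
  obtain ⟨M', hM'⟩ := Filter.eventually_atTop.1
    ((tendsto_rpow_atTop hp₀).eventually_ge_atTop (2 * c * γ))
  -- The three bounds give m > 0, small total noise, and a nonnegative contraction factor from the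
  -- first step on.
  refine ⟨max 1 (max M M'), lt_max_of_lt_left one_pos, fun m hm => ?_⟩
  have hm₀ : 0 < m := lt_of_lt_of_le one_pos ((le_max_left _ _).trans hm)
  have hsq := hM m (((le_max_left _ _).trans (le_max_right _ _)).trans hm)
  have hγm := hM' m (((le_max_right _ _).trans (le_max_right _ _)).trans hm)
  set r₁ := √(δ' / 2) * r
  have hr₁ : 0 < r₁ := by positivity
  have hr₁sq : r₁ ^ 2 = δ' / 2 * r ^ 2 := by
    rw [mul_pow, Real.sq_sqrt (by positivity)]
  have hδhalf : δ' ≤ 1 / 2 := min_le_right _ _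
  have hr₁r : r₁ ≤ r := by
    refine mul_le_of_le_one_left hr.le (Real.sqrt_le_one.2 ?_)
    linarith
  have hsum (N : ℕ) : r₁ ^ 2 + G ^ 2 *
      ∑ n ∈ Finset.range N, (γ / ((n + 1 : ℝ) + m) ^ p) ^ 2 ≤ δ' * r ^ 2 := by
    have h₁ : G ^ 2 * ∑ n ∈ Finset.range N, (γ / ((n + 1 : ℝ) + m) ^ p) ^ 2 ≤
        (G ^ 2 + 1) * (δ' * r ^ 2 / (2 * (G ^ 2 + 1))) :=
      mul_le_mul (by linarith) (hsq N) (by positivity) (by positivity)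
    have h₂ : (G ^ 2 + 1) * (δ' * r ^ 2 / (2 * (G ^ 2 + 1))) = δ' * r ^ 2 / 2 := by
      field_simp
    rw [hr₁sq]
    linarith
  set C := max (γ ^ 2 * G ^ 2) (r ^ 2 * (1 + m) ^ p)
  refine ⟨Metric.ball θs r, Metric.ball θs r₁, Metric.isOpen_ball, Metric.mem_ball_self hr,
    Metric.isOpen_ball, Metric.mem_ball_self hr₁, 2 * C, ?_⟩
  intro Ω _ P _ θ htraj _ hP
  have main {S : Type} [MeasurableSpace S] {ν : Measure S} {g : A.Param → S → A.Param}
      {ξ : ℕ → Ω → S} (h : SDGD.IsSGD P ν g (fun n => γ / ((n + 1 : ℝ) + m) ^ p) ξ θ)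
      (hg : Measurable (Function.uncurry g)) (hG : ∀ x ∈ Metric.ball θs r, ∀ s, ‖g x s‖ ≤ G)
      (hν : ∀ x v, ∫ s, inner ℝ (g x s) v ∂ν = inner ℝ (gradient pb.loss x) v) := by
    have hloc := h.local_convergence hg hc.le hr hG
      (fun x hx => (hmono x hx).trans_eq (hν x _).symm) (fun n => by positivity) hr₁r hδhalf hsum
      (fun a ha₀ ha => SDGD.le_div_rpow_of_recursion hp₀ hp' hm₀ hcγ hγm ha₀ ha) hP
    refine And.intro ((sub_le_sub_left (min_le_left δ (1 / 2)) 1).trans hloc.1) fun n =>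
      And.intro (hloc.2 n).1 ((hloc.2 n).2.trans_eq (mul_div_assoc _ _ _).symm)
  -- The existence of a trajectory forces the batch laws to be nonzero: their product is the law of
  -- a sample under a probability measure.
  have hprod {S T : Type} [MeasurableSpace S] [MeasurableSpace T] {μ : Measure S} {ν : Measure T}
      (hn : μ.prod ν ≠ 0) : μ ≠ 0 ∧ ν ≠ 0 :=
    ⟨fun h => hn (by rw [h, Measure.zero_prod]), fun h => hn (by rw [h, Measure.prod_zero])⟩
  rcases htraj with ⟨ξ, h⟩ | ⟨ξ, h⟩
  · have hn := hprod (h.law_sample 0 ▸ (Measure.isProbabilityMeasure_map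
      (h.measurable_sample 0).aemeasurable).ne_zero)
    have := sp.isProbabilityMeasure_law_of_ne_zero hn.1
    have := st.isProbabilityMeasure_law_of_ne_zero hn.2
    exact main h (SDGD.Problem.measurable_sdgdGrad1 hσ hop)
      (fun x hx s => (hG₁ x (Metric.ball_subset_closedBall hx) s).trans (le_max_left _ _))
      (SDGD.Problem.integral_inner_sdgdGrad1 hσ hop sp st hb hk)
  · have hn := hprod (h.law_sample 0 ▸ (Measure.isProbabilityMeasure_map
      (h.measurable_sample 0).aemeasurable).ne_zero)
    have hn' := hprod hn.2
    have := sp.isProbabilityMeasure_law_of_ne_zero hn.1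
    have := st.isProbabilityMeasure_law_of_ne_zero hn'.1
    have := st.isProbabilityMeasure_law_of_ne_zero hn'.2
    exact main h (SDGD.Problem.measurable_sdgdGrad2 hσ hop)
      (fun x hx s => (hG₂ x (Metric.ball_subset_closedBall hx) s).trans (le_max_right _ _))
      (SDGD.Problem.integral_inner_sdgdGrad2 hσ hop sp st hb hk hj)
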